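/- All graphs are finite and simple, with no isolated vertices. Let $\Delta(G)$ denote the maximum degree of a graph $G$, let $\nu(G)$ denote the number of edges in a maximum matching (a matching with the largest possible number of edges) of $G$, and let $\chi'(G)$ denote the chromatic index of $G$, i.e. the least number of colors in a proper edge coloring. The graph $G$ is of class II if $\chi'(G)=\Delta(G)+1$. **Theorem.** Let $G$ be a finite simple graph with no isolated vertices that is of class II and whose edge set $E(G)$ can be partitioned into maximum matchings of $G$. Then (a) $\Delta(G)$ is even; (b) $\frac{\Delta(G)}{2}$ divides $\nu(G)$; (c) every connected component of $G$ is isomorphic to the complete graph $K_{\Delta(G)+1}$, and $G$ has exactly $\frac{2\nu(G)}{\Delta(G)}$ components. In particular, this holds for all such $G$ with $\Delta(G)\ge 2$ and $\nu(G)\ge 2$. -/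

import Mathlib

namespace SimpleGraph

variable {V : Type*}

/-- The size (number of edges) of a maximum matching of `G`, denoted `ν(G)`.
For a finite graph the set below is nonempty and bounded, so this is a maximum. -/
noncomputable def matchingNumber (G : SimpleGraph V) : ℕ :=
  sSup {n : ℕ | ∃ M : G.Subgraph, M.IsMatching ∧ M.edgeSet.ncard = n}

/-- A matching of `G` is maximum if no matching of `G` has more edges. -/
def IsMaximumMatching (G : SimpleGraph V) (M : G.Subgraph) : Prop :=
  M.IsMatching ∧ ∀ M' : G.Subgraph, M'.IsMatching → M'.edgeSet.ncard ≤ M.edgeSet.ncard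

/-- The chromatic index `χ'(G)`: the least number of colors in an edge coloring of `G` in which
any two distinct edges sharing a vertex receive different colors. -/
noncomputable def chromaticIndex (G : SimpleGraph V) : ℕ∞ :=
  G.lineGraph.chromaticNumber

/-- A finite graph is of class II if its chromatic index is its maximum degree plus one. -/
def IsClassII (G : SimpleGraph V) [Fintype V] [DecidableRel G.Adj] : Prop :=
  G.chromaticIndex = ((G.maxDegree + 1 : ℕ) : ℕ∞)

/-- The edge set of `G` has a partition each of whose parts is (the edge set of) a maximum
matching of `G`. -/
def IsFriendlyEdgeColorable (G : SimpleGraph V) [Fintype V] [DecidableEq V]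
    [DecidableRel G.Adj] : Prop :=
  ∃ P : Finpartition G.edgeFinset, ∀ p ∈ P.parts,
    ∃ M : G.Subgraph, G.IsMaximumMatching M ∧ M.edgeSet = (p : Set (Sym2 V))

end SimpleGraph

/-! Write Δ and ν for the maximum degree and matching number. All k parts have size ν, so |E| = kν.
A proper colouring with Δ + 1 colours gives |E| ≤ (Δ + 1)ν, and class II forces k ≥ Δ + 1, so k = Δ
+ 1. Hence a vertex v is missed by Δ + 1 - deg v ≥ 1 of the matchings. Gallai's lemma
(`IsMaximumMatchingPerm.eq_of_reachable`) then says that each matching misses at most one vertex of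
a component C. By parity of |C|, each misses exactly one. Counting missed pairs gives ∑ (Δ + 1 - deg
v) = Δ + 1 over C, which together with deg v ≤ |C| - 1 leaves only |C| = Δ + 1 with all degrees Δ.
-/

namespace SimpleGraph

/-! ### Matchings as involutions, and Gallai's lemma -/

section InvolutiveMatching

variable {V : Type*} {G : SimpleGraph V}

/-- A matching of `G`, encoded as the involution that exchanges matched vertices and fixes the
unmatched ones. -/
structure IsMatchingPerm (G : SimpleGraph V) (σ : Equiv.Perm V) : Prop where
  apply_apply : ∀ v, σ (σ v) = v
  adj : ∀ v, σ v ≠ v → G.Adj v (σ v)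

/-- Matching two adjacent unmatched vertices. -/
theorem IsMatchingPerm.mul_swap [DecidableEq V] {σ : Equiv.Perm V} (h : G.IsMatchingPerm σ)
    {x y : V} (hxy : G.Adj x y) (hx : σ x = x) (hy : σ y = y) :
    G.IsMatchingPerm (σ * Equiv.swap x y) := by
  have key : ∀ v, (σ * Equiv.swap x y) v = if v = x then y else if v = y then x else σ v := by
    intro v
    simp only [Equiv.Perm.mul_apply, Equiv.swap_apply_def]
    split_ifs <;> simp_all
  have h1 := h.apply_apply
  have h2 := h.adj
  constructor
  · intro v
    simp only [key]
    grind
  · intro v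
    simp only [key]
    have := hxy.symm
    grind

/-- Replacing the matching edge between `y` and `σ y` by one between `y` and `x`. -/
theorem IsMatchingPerm.conj_swap [DecidableEq V] {σ : Equiv.Perm V} (h : G.IsMatchingPerm σ)
    {x y : V} (hxy : G.Adj x y) (hx : σ x = x) (hy : σ y ≠ y) :
    G.IsMatchingPerm (Equiv.swap x (σ y) * σ * (Equiv.swap x (σ y))⁻¹) ∧
    ∀ v, (Equiv.swap x (σ y) * σ * (Equiv.swap x (σ y))⁻¹) v =
      if v = x then y else if v = y then x else if v = σ y then σ y else σ v := by
  have h1 := h.apply_apply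
  have h2 := h.adj
  have hne := hxy.ne
  have key : ∀ v, (Equiv.swap x (σ y) * σ * (Equiv.swap x (σ y))⁻¹) v =
      if v = x then y else if v = y then x else if v = σ y then σ y else σ v := by
    intro v
    simp only [Equiv.swap_inv, Equiv.Perm.mul_apply, Equiv.swap_apply_def]
    grind
  refine ⟨⟨fun v => ?_, fun v => ?_⟩, key⟩
  · simp only [key]
    grind
  · simp only [key]
    have := hxy.symm
    grind

variable [Fintype V] [DecidableEq V]

/-- A matching permutation covering as many vertices as possible. -/
def IsMaximumMatchingPerm (G : SimpleGraph V) (σ : Equiv.Perm V) : Prop :=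
  G.IsMatchingPerm σ ∧ ∀ τ, G.IsMatchingPerm τ → τ.support.card ≤ σ.support.card

theorem IsMaximumMatchingPerm.not_adj {σ : Equiv.Perm V} (h : G.IsMaximumMatchingPerm σ)
    {x y : V} (hx : σ x = x) (hy : σ y = y) : ¬ G.Adj x y := by
  intro hxy
  have hmul := h.2 _ (h.1.mul_swap hxy hx hy)
  rw [Equiv.Perm.Disjoint.card_support_mul, Equiv.Perm.card_support_swap hxy.ne] at hmul
  · lia
  · intro v
    by_cases hvx : v = x
    · exact Or.inl (hvx ▸ hx)
    by_cases hvy : v = y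
    · exact Or.inl (hvy ▸ hy)
    exact Or.inr (Equiv.swap_apply_of_ne_of_ne hvx hvy)

theorem IsMaximumMatchingPerm.card_support_eq {σ τ : Equiv.Perm V}
    (h : G.IsMaximumMatchingPerm σ) (h' : G.IsMaximumMatchingPerm τ) :
    σ.support.card = τ.support.card :=
  le_antisymm (h'.2 _ h.1) (h.2 _ h'.1)

/-- Transitivity step in Gallai's lemma: the relation "no maximum matching misses both" is
transitive through a vertex missed by some maximum matching. -/
theorem IsMaximumMatchingPerm.gallai_trans {u v w : V} (huv : u ≠ v)
    (hw : ∃ τ, G.IsMaximumMatchingPerm τ ∧ τ w = w)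
    (huw : ∀ τ, G.IsMaximumMatchingPerm τ → τ u = u → τ w ≠ w)
    (hwv : ∀ τ, G.IsMaximumMatchingPerm τ → τ w = w → τ v ≠ v)
    {σ : Equiv.Perm V} (hσ : G.IsMaximumMatchingPerm σ) (hu : σ u = u) : σ v ≠ v := by
  classical
  intro hv
  -- Among the maximum matchings missing `w`, take `τ` agreeing with `σ` as much as possible; an
  -- exchange will improve it.
  let A : Equiv.Perm V → Finset V := fun τ => {a | σ a ≠ a ∧ τ a = σ a}
  obtain ⟨τ, hτ, hmax⟩ := Finset.exists_max_image
    ({τ | G.IsMaximumMatchingPerm τ ∧ τ w = w} : Finset (Equiv.Perm V)) (fun τ => (A τ).card)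
    (by obtain ⟨τ, h⟩ := hw; exact ⟨τ, by simpa using h⟩)
  simp only [Finset.mem_filter, Finset.mem_univ, true_and] at hτ hmax
  obtain ⟨hτm, hτw⟩ := hτ
  have hσw : σ w ≠ w := huw σ hσ hu
  have hτu : τ u ≠ u := fun h => huw τ hτm h hτw
  have hτv : τ v ≠ v := hwv τ hτm hτw
  -- Only `τ` covers `u` and `v`, so `σ` alone covers at least two vertices, one of them other than
  -- `w`.
  have hcard : (σ.support \ τ.support).card = (τ.support \ σ.support).card :=
    Finset.card_sdiff_comm (hσ.card_support_eq hτm)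
  have h2 : 1 < (τ.support \ σ.support).card :=
    Finset.one_lt_card.2 ⟨u, by simp [hτu, hu], v, by simp [hτv, hv], huv⟩
  obtain ⟨x, hx, hxw⟩ := Finset.exists_mem_ne (hcard ▸ h2) w
  simp only [Finset.mem_sdiff, Equiv.Perm.mem_support, not_not] at hx
  obtain ⟨hσx, hτx⟩ := hx
  have hxy : G.Adj x (σ x) := hσ.1.adj x hσx
  have hτy : τ (σ x) ≠ σ x := fun h => hτm.not_adj hτx h hxy
  obtain ⟨hconj, hval⟩ := hτm.1.conj_swap hxy hτx hτy
  -- The exchange gains the `σ`-edge at `x`; the edge given up joins `σ x` to a vertex other than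
  -- `x`, so it is not in `σ`.
  set τ' := Equiv.swap x (τ (σ x)) * τ * (Equiv.swap x (τ (σ x)))⁻¹
  have hτ'm : G.IsMaximumMatchingPerm τ' :=
    ⟨hconj, fun ρ hρ => (hτm.2 ρ hρ).trans_eq (Equiv.Perm.card_support_conj).symm⟩
  have hσσ := hσ.1.apply_apply
  have hττ := hτm.1.apply_apply
  have hτ'w : τ' w = w := by rw [hval]; grind
  have hlt : (A τ).card < (A τ').card := by
    apply Finset.card_lt_card
    rw [Finset.ssubset_iff_of_subset]
    · exact ⟨x, by simp [A, hσx, hval], by simp [A, hτx, hσx.symm]⟩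
    · intro a
      simp only [A, Finset.mem_filter, Finset.mem_univ, true_and, hval]
      grind
  exact absurd (hmax τ' ⟨hτ'm, hτ'w⟩) (not_le.2 hlt)

/-- Gallai's lemma: if every vertex is missed by some maximum matching, then a maximum matching
misses at most one vertex of each connected component. -/
theorem IsMaximumMatchingPerm.eq_of_reachable
    (hmiss : ∀ w, ∃ τ, G.IsMaximumMatchingPerm τ ∧ τ w = w) {u v : V} (huv : G.Reachable u v)
    {σ : Equiv.Perm V} (hσ : G.IsMaximumMatchingPerm σ) (hu : σ u = u) (hv : σ v = v) :
    u = v := by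
  obtain ⟨p⟩ := huv
  induction p generalizing σ with
  | nil => rfl
  | @cons u w v h p ih =>
    by_contra hne
    by_cases hwv : w = v
    · subst hwv
      exact hσ.not_adj hu hv h
    -- No maximum matching misses both `u` and `w`, by adjacency, nor both `w` and `v`, by
    -- induction.
    · exact gallai_trans hne (hmiss w) (fun τ hτ h1 h2 => hτ.not_adj h1 h2 h)
        (fun τ hτ h1 h2 => hwv (ih hτ h1 h2)) hσ hu hv

/-- An involution of a finite set moves an even number of points. -/
theorem even_card_filter_apply_ne {α : Type*} [DecidableEq α] (s : Finset α) (f : α → α)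
    (hf : ∀ a, f (f a) = a) (hs : ∀ a ∈ s, f a ∈ s) : Even (s.filter fun a => f a ≠ a).card := by
  have h : ∑ _a ∈ s.filter (fun a => f a ≠ a), (1 : ZMod 2) = 0 := by
    refine Finset.sum_involution (fun a _ => f a) (fun _ _ => by decide) ?_ ?_ ?_
    · intro a ha _
      exact (Finset.mem_filter.1 ha).2
    · intro a ha
      rw [Finset.mem_filter] at ha ⊢
      refine ⟨hs a ha.1, fun h => ha.2 ?_⟩
      rw [hf] at h
      exact h.symm
    · intro a _
      exact hf a
  rw [Finset.sum_const, nsmul_one] at h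
  exact (ZMod.natCast_eq_zero_iff_even).1 h

end InvolutiveMatching

/-! ### Passing between subgraph matchings and involutions -/

section SubgraphMatching

variable {V : Type*} {G : SimpleGraph V} {M : G.Subgraph}

/-- Every matching is encoded by a matching permutation. -/
theorem Subgraph.IsMatching.exists_isMatchingPerm (hM : M.IsMatching) :
    ∃ σ, G.IsMatchingPerm σ ∧ ∀ v w, M.Adj v w ↔ σ v = w ∧ v ≠ w := by
  classical
  choose f hf using fun v (hv : v ∈ M.verts) => (hM hv).exists
  let g : V → V := fun v => if hv : v ∈ M.verts then f v hv else v
  have hg : ∀ v w, M.Adj v w ↔ g v = w ∧ v ≠ w := by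
    intro v w
    by_cases hv : v ∈ M.verts
    · simp only [g, hv, dif_pos]
      refine ⟨fun h => ⟨hM.eq_of_adj_left (hf v hv) h, h.ne⟩, fun h => h.1 ▸ hf v hv⟩
    · simp only [g, hv, dif_neg, not_false_eq_true]
      exact ⟨fun h => absurd h.fst_mem hv, fun h => absurd h.1 h.2⟩
  have hgg : Function.Involutive g := by
    intro v
    by_cases h : g v = v
    · rw [h, h]
    · exact ((hg _ _).1 ((hg v (g v)).2 ⟨rfl, Ne.symm h⟩).symm).1
  exact ⟨hgg.toPerm, ⟨hgg, fun v hv => ((hg v _).2 ⟨rfl, Ne.symm hv⟩).adj_sub⟩, hg⟩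

/-- Every matching permutation comes from a matching. -/
theorem IsMatchingPerm.exists_isMatching {σ : Equiv.Perm V} (h : G.IsMatchingPerm σ) :
    ∃ M : G.Subgraph, M.IsMatching ∧ ∀ v w, M.Adj v w ↔ σ v = w ∧ v ≠ w := by
  refine ⟨⟨{v | σ v ≠ v}, fun v w => σ v = w ∧ v ≠ w, ?_, ?_, ⟨?_⟩⟩, ?_, fun _ _ => Iff.rfl⟩
  · rintro v _ ⟨rfl, hv⟩
    exact h.adj v hv.symm
  · rintro v _ ⟨rfl, hv⟩
    exact hv.symm
  · rintro v _ ⟨rfl, hv⟩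
    exact ⟨h.apply_apply v, hv.symm⟩
  · intro v hv
    exact ⟨σ v, ⟨rfl, Ne.symm hv⟩, fun w hw => hw.1.symm⟩

theorem IsMaximumMatching.matchingNumber_eq (hM : G.IsMaximumMatching M) :
    G.matchingNumber = M.edgeSet.ncard := by
  refine IsGreatest.csSup_eq ⟨⟨M, hM.1, rfl⟩, ?_⟩
  rintro _ ⟨M', hM', rfl⟩
  exact hM.2 M' hM'

variable [Fintype V] [DecidableEq V]

/-- Handshake lemma: a vertex has degree 1 in `M` if `σ` moves it and 0 otherwise. -/
theorem card_support_eq_two_mul_ncard_edgeSet {σ : Equiv.Perm V}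
    (h : ∀ v w, M.Adj v w ↔ σ v = w ∧ v ≠ w) : σ.support.card = 2 * M.edgeSet.ncard := by
  classical
  have hsum := M.spanningCoe.sum_degrees_eq_twice_card_edges
  rw [← Set.ncard_coe_finset, coe_edgeFinset, Subgraph.edgeSet_spanningCoe] at hsum
  rw [← hsum, Finset.card_eq_sum_ones, Equiv.Perm.support, Finset.sum_filter]
  refine Finset.sum_congr rfl fun v _ => ?_
  have : M.spanningCoe.neighborFinset v = if σ v ≠ v then {σ v} else ∅ := by
    ext w
    rw [mem_neighborFinset, Subgraph.spanningCoe_adj, h]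
    split_ifs <;> grind
  rw [← card_neighborFinset_eq_degree, this]
  split_ifs <;> rfl

theorem IsMaximumMatching.exists_isMaximumMatchingPerm (hM : G.IsMaximumMatching M) :
    ∃ σ, G.IsMaximumMatchingPerm σ ∧ ∀ v w, M.Adj v w ↔ σ v = w ∧ v ≠ w := by
  obtain ⟨σ, hσ, h⟩ := hM.1.exists_isMatchingPerm
  refine ⟨σ, ⟨hσ, fun τ hτ => ?_⟩, h⟩
  obtain ⟨M', hM', h'⟩ := hτ.exists_isMatching
  rw [card_support_eq_two_mul_ncard_edgeSet h, card_support_eq_two_mul_ncard_edgeSet h']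
  exact Nat.mul_le_mul_left 2 (hM.2 M' hM')

end SubgraphMatching

/-! ### Edge colourings and partitions into matchings -/

section Coloring

variable {V : Type*} {G : SimpleGraph V}

/-- A set of pairwise nonincident edges is the edge set of a matching. -/
theorem exists_isMatching_edgeSet_eq {s : Set (Sym2 V)} (hs : s ⊆ G.edgeSet)
    (hdisj : ∀ v w w', s(v, w) ∈ s → s(v, w') ∈ s → w = w') :
    ∃ M : G.Subgraph, M.IsMatching ∧ M.edgeSet = s := by
  refine ⟨⟨{v | ∃ w, s(v, w) ∈ s}, fun v w => s(v, w) ∈ s, fun h => hs h, fun h => ⟨_, h⟩,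
    ⟨fun v w h => Sym2.eq_swap ▸ h⟩⟩, ?_, ?_⟩
  · rintro v ⟨w, hw⟩
    exact ⟨w, hw, fun w' hw' => hdisj v w' w hw' hw⟩
  · ext e
    induction e with | _ v w => rfl

/-- In a proper edge coloring, the color classes are matchings, so the number of edges is at most
the number of colors times the size of a maximum matching. -/
theorem card_edgeFinset_le_of_colorable_lineGraph [Fintype V] [DecidableRel G.Adj] [DecidableEq V]
    {n : ℕ} (hc : G.lineGraph.Colorable n) {M : G.Subgraph} (hM : G.IsMaximumMatching M) :
    G.edgeFinset.card ≤ n * M.edgeSet.ncard := by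
  classical
  obtain ⟨c⟩ := hc
  have hcard : G.edgeFinset.card = (Finset.univ : Finset G.edgeSet).card := by
    rw [Finset.card_univ, edgeFinset_card]
  rw [hcard, mul_comm]
  have := Finset.card_le_mul_card_image_of_maps_to (s := (Finset.univ : Finset G.edgeSet))
    (f := c) (t := Finset.univ) (fun _ _ => Finset.mem_univ _) M.edgeSet.ncard ?_
  · simpa using this
  intro i _
  obtain ⟨M', hM', he⟩ := exists_isMatching_edgeSet_eq (G := G)
    (s := Subtype.val '' {e : G.edgeSet | c e = i}) (by rintro _ ⟨e, -, rfl⟩; exact e.2) (by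
      rintro v w w' ⟨⟨_, hw⟩, hcw, rfl⟩ ⟨⟨_, hw'⟩, hcw', rfl⟩
      by_contra hne
      refine c.valid (v := ⟨s(v, w), hw⟩) (w := ⟨s(v, w'), hw'⟩) ⟨?_, v, ?_⟩
        (Eq.trans hcw (Eq.symm hcw'))
      · intro h
        exact hne (Sym2.congr_right.1 (congrArg Subtype.val h))
      · simp)
  have := hM.2 M' hM'
  rw [he, Set.ncard_image_of_injective _ Subtype.val_injective] at this
  refine le_trans (le_of_eq ?_) this
  rw [← Set.ncard_coe_finset]
  congr 1
  ext e
  simp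

/-- A partition of the edge set into matchings is a proper edge coloring. -/
theorem colorable_lineGraph_of_finpartition [Fintype V] [DecidableRel G.Adj] [DecidableEq V]
    (P : Finpartition G.edgeFinset)
    (hP : ∀ p ∈ P.parts, ∃ M : G.Subgraph, M.IsMatching ∧ M.edgeSet = (p : Set (Sym2 V))) :
    G.lineGraph.Colorable P.parts.card := by
  have hmem : ∀ e : G.edgeSet, (e : Sym2 V) ∈ G.edgeFinset := fun e => mem_edgeFinset.2 e.2
  have c : G.lineGraph.Coloring P.parts := by
    refine Coloring.mk (fun e => ⟨P.part e, P.part_mem.2 (hmem e)⟩) ?_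
    rintro ⟨e, he⟩ ⟨e', he'⟩ ⟨hne, v, hv, hv'⟩ heq
    obtain ⟨M, hM, hMp⟩ := hP _ (P.part_mem.2 (hmem ⟨e, he⟩))
    have h1 : e ∈ M.edgeSet := hMp ▸ P.mem_part (hmem ⟨e, he⟩)
    have h2 : e' ∈ M.edgeSet := by
      have hpart : P.part e = P.part e' := congrArg Subtype.val heq
      rw [hMp, hpart]
      exact P.mem_part (hmem ⟨e', he'⟩)
    obtain ⟨w, rfl⟩ := hv
    obtain ⟨w', rfl⟩ := hv'
    exact hne (Subtype.ext (congrArg (fun x => s(v, x)) (hM.eq_of_adj_left h1 h2)))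
  simpa using c.colorable

end Coloring

/-! ### Counting missed vertices in a component -/

section Components

variable {V ι : Type*} [Fintype V] [DecidableEq V] [Fintype ι] {G : SimpleGraph V}
  [DecidableRel G.Adj] {σ : ι → Equiv.Perm V}

theorem card_filter_apply_ne_eq_degree (hσ : ∀ i, G.IsMatchingPerm (σ i))
    (hex : ∀ v w, G.Adj v w → ∃! i, σ i v = w) (v : V) :
    (Finset.univ.filter fun i => σ i v ≠ v).card = G.degree v := by
  rw [← card_neighborFinset_eq_degree]
  refine Finset.card_bij (fun i _ => σ i v) ?_ ?_ ?_
  · intro i hi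
    exact (mem_neighborFinset _ _ _).2 ((hσ i).adj v (Finset.mem_filter.1 hi).2)
  · intro i hi j _ hij
    exact (hex v _ ((hσ i).adj v (Finset.mem_filter.1 hi).2)).unique rfl hij.symm
  · intro w hw
    have hvw := (mem_neighborFinset _ _ _).1 hw
    obtain ⟨i, hi, -⟩ := hex v w hvw
    exact ⟨i, by simp [hi, hvw.ne'], hi⟩

theorem card_filter_apply_eq_add_degree (hσ : ∀ i, G.IsMatchingPerm (σ i))
    (hex : ∀ v w, G.Adj v w → ∃! i, σ i v = w) (v : V) :
    (Finset.univ.filter fun i => σ i v = v).card + G.degree v = Fintype.card ι := by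
  rw [← card_filter_apply_ne_eq_degree hσ hex v, Finset.card_filter_add_card_filter_not,
    Finset.card_univ]

/-- If the edges of `G` are partitioned into `Δ(G) + 1` maximum matchings, then each nontrivial
component has `Δ(G) + 1` vertices, all of degree `Δ(G)`, each of the matchings misses exactly
one of them, and `Δ(G)` is even. -/
theorem component_of_partition_isMaximumMatchingPerm
    (hiso : ∀ v, ¬ G.IsIsolated v) (hσ : ∀ i, G.IsMaximumMatchingPerm (σ i))
    (hex : ∀ v w, G.Adj v w → ∃! i, σ i v = w) (hcard : Fintype.card ι = G.maxDegree + 1)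
    (C : G.ConnectedComponent) (s : Finset V) (hs : ∀ v, v ∈ s ↔ G.connectedComponentMk v = C) :
    s.card = G.maxDegree + 1 ∧ (∀ v ∈ s, G.degree v = G.maxDegree) ∧
      (∀ i, (s.filter fun v => σ i v = v).card = 1) ∧ Even G.maxDegree := by
  have hdeg := card_filter_apply_eq_add_degree (fun i => (hσ i).1) hex
  have hpos : ∀ v, 0 < (Finset.univ.filter fun i => σ i v = v).card := fun v => by
    have := hdeg v
    have := G.degree_le_maxDegree v
    lia
  have hmiss : ∀ v, ∃ i, σ i v = v := fun v => by
    obtain ⟨i, hi⟩ := Finset.card_pos.1 (hpos v)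
    exact ⟨i, (Finset.mem_filter.1 hi).2⟩
  have hle : ∀ i, (s.filter fun v => σ i v = v).card ≤ 1 := fun i => by
    refine Finset.card_le_one.2 fun u hu v hv => ?_
    rw [Finset.mem_filter, hs] at hu hv
    exact IsMaximumMatchingPerm.eq_of_reachable
      (fun w => (hmiss w).imp' σ fun j hj => ⟨hσ j, hj⟩)
      (ConnectedComponent.exact (hu.1.trans hv.1.symm)) (hσ i) hu.2 hv.2
  have hsplit : ∀ i, (s.filter fun v => σ i v = v).card + (s.filter fun v => σ i v ≠ v).card =
      s.card := fun i => Finset.card_filter_add_card_filter_not _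
  have heven : ∀ i, Even (s.filter fun v => σ i v ≠ v).card := fun i => by
    refine even_card_filter_apply_ne s (σ i) (hσ i).1.apply_apply fun v hv => ?_
    by_cases h : σ i v = v
    · rwa [h]
    · rw [hs] at hv ⊢
      rw [← hv]
      exact (ConnectedComponent.sound ((hσ i).1.adj v h).reachable).symm
  obtain ⟨v₀, hv₀⟩ := C.exists_rep
  have hv₀s : v₀ ∈ s := (hs v₀).2 hv₀
  have hone : ∀ i, (s.filter fun v => σ i v = v).card = 1 := by
    obtain ⟨j, hj⟩ := hmiss v₀
    have h1 : 0 < (s.filter fun v => σ j v = v).card :=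
      Finset.card_pos.2 ⟨v₀, Finset.mem_filter.2 ⟨hv₀s, hj⟩⟩
    -- The number missed has the parity of `s.card` for every matching, is at most 1, and is 1 for
    -- `j`.
    intro i
    have := hle i
    have := hle j
    have := hsplit i
    have := hsplit j
    have := heven i
    have := heven j
    grind
  have hsum : ∑ v ∈ s, (Finset.univ.filter fun i => σ i v = v).card = G.maxDegree + 1 := by
    rw [← hcard, ← Finset.card_univ, Finset.card_eq_sum_ones, ← Finset.sum_congr rfl
      fun i _ => hone i]
    exact Finset.sum_card_bipartiteAbove_eq_sum_card_bipartiteBelow fun v i => σ i v = v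
  have hneigh : ∀ v ∈ s, G.degree v + 1 ≤ s.card := fun v hv => by
    rw [← card_neighborFinset_eq_degree, ← Finset.card_erase_add_one hv]
    refine Nat.add_le_add_right (Finset.card_le_card fun w hw => ?_) 1
    rw [mem_neighborFinset] at hw
    exact Finset.mem_erase.2
      ⟨hw.ne', (hs w).2 (((hs v).1 hv) ▸ (ConnectedComponent.sound hw.reachable).symm)⟩
  have htwo : 2 ≤ s.card := by
    have h0 : 0 < G.degree v₀ := by
      obtain ⟨w, hw⟩ := not_forall_not.1 (hiso v₀)
      exact (G.degree_pos_iff_exists_adj v₀).2 ⟨w, hw⟩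
    have := hneigh v₀ hv₀s
    lia
  have hle_card : s.card ≤ G.maxDegree + 1 := by
    rw [← hsum, Finset.card_eq_sum_ones]
    exact Finset.sum_le_sum fun v _ => hpos v
  obtain ⟨d, hd⟩ := Nat.exists_eq_add_of_le hle_card
  -- Each vertex is missed at least Δ + 2 - |s| = `d + 1` times. With |s| ≥ 2 this forces `d = 0`.
  have hge : s.card * (d + 1) ≤ s.card + d := by
    rw [← hd, ← hsum, ← smul_eq_mul]
    refine Finset.card_nsmul_le_sum _ _ _ fun v hv => ?_
    have := hdeg v
    have := hneigh v hv
    lia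
  have hd0 : d = 0 := by nlinarith
  have hcards : s.card = G.maxDegree + 1 := by lia
  refine ⟨hcards, fun v hv => ?_, hone, ?_⟩
  rotate_left
  · obtain ⟨j, -⟩ := hmiss v₀
    have := hone j
    have := hsplit j
    have := heven j
    rwa [show G.maxDegree = (s.filter fun v => σ j v ≠ v).card by lia]
  -- The |s| positive terms sum to |s|, so each is 1.
  have heq := (Finset.sum_eq_sum_iff_of_le fun v _ => Nat.succ_le_of_lt (hpos v)).1
    (by rw [hsum, ← hcards, Finset.card_eq_sum_ones] : ∑ v ∈ s, 1 = _) v hv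
  have := hdeg v
  lia

/-- A component of order `n + 1` all of whose vertices have degree `n` is complete. -/
theorem ConnectedComponent.nonempty_iso_completeGraph {n : ℕ}
    (C : G.ConnectedComponent) (s : Finset V) (hs : ∀ v, v ∈ s ↔ G.connectedComponentMk v = C)
    (hcard : s.card = n + 1) (hdeg : ∀ v ∈ s, G.degree v = n) :
    Nonempty (C.toSimpleGraph ≃g completeGraph (Fin (n + 1))) := by
  have hmem : ∀ v : C, (v : V) ∈ s := fun v => (hs v).2 v.2
  have hneigh : ∀ v ∈ s, G.neighborFinset v = s.erase v := fun v hv => by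
    refine Finset.eq_of_subset_of_card_le (fun w hw => ?_) ?_
    · rw [mem_neighborFinset] at hw
      exact Finset.mem_erase.2
        ⟨hw.ne', (hs w).2 (((hs v).1 hv) ▸ (ConnectedComponent.sound hw.reachable).symm)⟩
    · rw [Finset.card_erase_of_mem hv, hcard, card_neighborFinset_eq_degree, hdeg v hv]
      rfl
  have e : C ≃ Fin (n + 1) :=
    (Equiv.subtypeEquivRight fun v => (hs v).symm).trans (s.equivFinOfCardEq hcard)
  refine ⟨⟨e, fun {a b} => ?_⟩⟩
  change e a ≠ e b ↔ G.Adj a b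
  rw [← mem_neighborFinset, hneigh a (hmem a), Finset.mem_erase, e.injective.ne_iff,
    Ne, Subtype.ext_iff]
  exact ⟨fun h => ⟨fun h' => h h'.symm, hmem b⟩, fun h h' => h.1 h'.symm⟩

end Components

end SimpleGraph

theorem mainTheorem2 {V : Type*} [Fintype V] [DecidableEq V]
    (G : SimpleGraph V) [DecidableRel G.Adj]
    (hiso : ∀ v : V, ¬ G.IsIsolated v)
    (hII : G.IsClassII)
    (hG : G.IsFriendlyEdgeColorable) :
    Even G.maxDegree ∧
    G.maxDegree / 2 ∣ G.matchingNumber ∧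
    (∀ C : G.ConnectedComponent,
      Nonempty (C.toSimpleGraph ≃g SimpleGraph.completeGraph (Fin (G.maxDegree + 1)))) ∧
    (Nat.card G.ConnectedComponent : ℚ) = 2 * (G.matchingNumber : ℚ) / (G.maxDegree : ℚ) := by
  classical
  obtain ⟨P, hP⟩ := hG
  choose! M hM hMe using hP
  have hcolor := SimpleGraph.colorable_lineGraph_of_finpartition P
    fun p hp => ⟨M p, (hM p hp).1, hMe p hp⟩
  have hge : G.maxDegree + 1 ≤ P.parts.card := by
    have := hcolor.chromaticNumber_le
    rw [SimpleGraph.IsClassII, SimpleGraph.chromaticIndex] at hII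
    rw [hII] at this
    exact_mod_cast this
  obtain ⟨p₀, hp₀⟩ := Finset.card_pos.1 (Nat.succ_pos _ |>.trans_le hge)
  have hpcard : ∀ p ∈ P.parts, p.card = G.matchingNumber := fun p hp => by
    rw [(hM p hp).matchingNumber_eq, hMe p hp, Set.ncard_coe_finset]
  have hνpos : 0 < G.matchingNumber := by
    rw [← hpcard p₀ hp₀]
    exact Finset.card_pos.2 (P.nonempty_of_mem_parts hp₀)
  have hle : P.parts.card ≤ G.maxDegree + 1 := by
    have hcol : G.lineGraph.Colorable (G.maxDegree + 1) :=
      SimpleGraph.chromaticNumber_le_iff_colorable.1 hII.le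
    have h := SimpleGraph.card_edgeFinset_le_of_colorable_lineGraph hcol (hM p₀ hp₀)
    rw [← P.sum_card_parts, Finset.sum_congr rfl hpcard, Finset.sum_const, smul_eq_mul,
      ← (hM p₀ hp₀).matchingNumber_eq] at h
    exact Nat.le_of_mul_le_mul_right h hνpos
  have hcard : Fintype.card P.parts = G.maxDegree + 1 := by
    rw [Fintype.card_coe]
    exact le_antisymm hle hge
  choose σ hσ hMσ using fun p : P.parts => (hM p p.2).exists_isMaximumMatchingPerm
  have hadj : ∀ (p : P.parts) v w, v ≠ w → (σ p v = w ↔ s(v, w) ∈ (p : Finset (Sym2 V))) := by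
    intro p v w hvw
    rw [← Finset.mem_coe, ← hMe p p.2, SimpleGraph.Subgraph.mem_edgeSet, hMσ p]
    exact ⟨fun h => ⟨h, hvw⟩, fun h => h.1⟩
  have hex : ∀ v w, G.Adj v w → ∃! p, σ p v = w := by
    intro v w hvw
    obtain ⟨p, ⟨hp, hmem⟩, huniq⟩ := P.existsUnique_mem
      (SimpleGraph.mem_edgeFinset (e := s(v, w)) |>.2 hvw)
    exact ⟨⟨p, hp⟩, (hadj _ v w hvw.ne).2 hmem,
      fun q hq => Subtype.ext (huniq q ⟨q.2, (hadj q v w hvw.ne).1 hq⟩)⟩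
  let s : G.ConnectedComponent → Finset V := fun C => {v | G.connectedComponentMk v = C}
  have hs : ∀ C v, v ∈ s C ↔ G.connectedComponentMk v = C := fun C v => by simp [s]
  have key := fun C => SimpleGraph.component_of_partition_isMaximumMatchingPerm hiso hσ hex hcard
    C (s C) (hs C)
  have hsupp := SimpleGraph.card_support_eq_two_mul_ncard_edgeSet (hMσ ⟨p₀, hp₀⟩)
  rw [← (hM p₀ hp₀).matchingNumber_eq] at hsupp
  have hV : Fintype.card V = Fintype.card G.ConnectedComponent * (G.maxDegree + 1) := by
    rw [← Finset.card_univ, Finset.card_eq_sum_card_fiberwise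
      (f := G.connectedComponentMk) (t := Finset.univ) (fun _ _ => Finset.mem_univ _),
      Finset.sum_congr rfl fun C _ => (key C).1, Finset.sum_const, smul_eq_mul, Finset.card_univ]
  have hfix : (Finset.univ.filter fun v => σ ⟨p₀, hp₀⟩ v = v).card =
      Fintype.card G.ConnectedComponent := by
    rw [Finset.card_eq_sum_card_fiberwise
      (f := G.connectedComponentMk) (t := Finset.univ) (fun _ _ => Finset.mem_univ _),
      ← Finset.card_univ, Finset.card_eq_sum_ones]
    refine Finset.sum_congr rfl fun C _ => ?_
    rw [Finset.filter_comm]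
    exact (key C).2.2.1 _
  -- One matching covers all but one of the Δ + 1 vertices of each component.
  have hcount : 2 * G.matchingNumber = Fintype.card G.ConnectedComponent * G.maxDegree := by
    have h := Finset.card_filter_add_card_filter_not (s := Finset.univ)
      (fun v => σ ⟨p₀, hp₀⟩ v = v)
    rw [Finset.card_univ, hV, hfix] at h
    change _ + (σ ⟨p₀, hp₀⟩).support.card = _ at h
    rw [hsupp, mul_add, mul_one] at h
    lia
  have hΔ : G.maxDegree ≠ 0 := by
    intro h
    rw [h] at hcount
    lia
  have hC : Nonempty G.ConnectedComponent := by
    by_contra h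
    rw [not_nonempty_iff] at h
    rw [Fintype.card_eq_zero] at hcount
    lia
  have heven : Even G.maxDegree := (key hC.some).2.2.2
  refine ⟨heven, ?_, fun C => ?_, ?_⟩
  · obtain ⟨m, hm⟩ := heven
    rw [hm] at hcount
    refine ⟨Fintype.card G.ConnectedComponent, ?_⟩
    rw [hm, show (m + m) / 2 = m by lia]
    nlinarith
  · exact C.nonempty_iso_completeGraph (s C) (hs C) (key C).1 (key C).2.1
  · rw [eq_div_iff (Nat.cast_ne_zero.2 hΔ), Nat.card_eq_fintype_card]
    exact_mod_cast hcount.symm
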